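/- Let $m,n\ge 0$ and let $K$ be an (abstract) simplicial complex on the set $[m]=\{1,\dots,m\}$, i.e. a collection of subsets of $[m]$ (the simplices) that contains $\emptyset$ and is closed under taking subsets; in particular $K$ may be any simplicial complex with exactly $m$ vertices, but one-element subsets of $[m]$ are not required to lie in $K$. Let $|K|=\bigcup_{\emptyset\ne I\in K}\operatorname{conv}\{e_i : i\in I\}\subset\mathbb R^m$ be its geometric realisation, and suppose that $K$ is a simplicial $(n-1)$-sphere, i.e. that $|K|$ is homeomorphic to the unit sphere $S^{n-1}\subset\mathbb R^n$ (with $S^{-1}=\emptyset$). Let $$\operatorname{cc}(K)=\bigcup_{I\subset J\in K}C_{I\subset J}\subset[0,1]^m,\qquad C_{I\subset J}=\{y\in[0,1]^m : y_i=0\ (i\in I),\ y_i=1\ (i\notin J)\},$$ and let $$\mathcal Z_K=\{z\in\mathbb C^m : |z_i|\le 1 \text{ for all } i,\ (|z_1|,\dots,|z_m|)\in\operatorname{cc}(K)\}$$ be the moment-angle complex of $K$, with the subspace topology. Then $\mathcal Z_K$ is a closed topological manifold of dimension $m+n$: it is Hausdorff, second countable, compact, connected, and every point of it has an open neighbourhood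 homeomorphic to an open subset of $\mathbb R^{m+n}$. -/

import Mathlib

/-- The polyhedron `|K| ⊆ ℝ^m` of a simplicial complex `K` on the set `[m]`: the union of the
geometric simplices `Δ_I = conv {e_i : i ∈ I}` over the (non-empty) simplices `I` of `K`. Elements
of `[m]` that are not vertices of `K` are allowed. -/
def geomRealization {m : ℕ} (K : PreAbstractSimplicialComplex (Fin m)) : Set (Fin m → ℝ) :=
  ⋃ I ∈ K.faces, convexHull ℝ ((fun i : Fin m => (Pi.single i 1 : Fin m → ℝ)) '' (I : Set (Fin m)))

/-- `K` is a simplicial `(n-1)`-sphere: `|K|` is homeomorphic to the unit sphere of `ℝ^n`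
(which is empty for `n = 0`). -/
def IsSimplicialSphere {m : ℕ} (n : ℕ) (K : PreAbstractSimplicialComplex (Fin m)) : Prop :=
  Nonempty (geomRealization K ≃ₜ Metric.sphere (0 : EuclideanSpace ℝ (Fin n)) 1)

/-- The face `C_{I ⊆ J}` of the standard cube `I^m = [0,1]^m`, for `I ⊆ J ⊆ [m]`. -/
def cubeFace {m : ℕ} (I J : Finset (Fin m)) : Set (Fin m → ℝ) :=
  {y | (∀ i, y i ∈ Set.Icc (0 : ℝ) 1) ∧ (∀ i ∈ I, y i = 0) ∧ (∀ i ∉ J, y i = 1)}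

/-- The cubical complex `cc(K) ⊆ I^m`: the union of the faces `C_{I ⊆ J}` over all simplices `J`
of `K`, the empty simplex included (Mathlib's complexes list the non-empty simplices only). -/
def cubicalCone {m : ℕ} (K : PreAbstractSimplicialComplex (Fin m)) : Set (Fin m → ℝ) :=
  {y | ∃ I J : Finset (Fin m), I ⊆ J ∧ (J = ∅ ∨ J ∈ K.faces) ∧ y ∈ cubeFace I J}

/-- The unit polydisc `(D²)^m ⊆ ℂ^m`. -/
def polydisc (m : ℕ) : Set (Fin m → ℂ) :=
  {z | ∀ i, ‖z i‖ ≤ 1}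

/-- The orbit map `ρ : (z_1, …, z_m) ↦ (|z_1|, …, |z_m|)` of the action of the torus `T^m`; it
takes the polydisc `(D²)^m` onto the cube `I^m`. -/
noncomputable def orbitMap {m : ℕ} (z : Fin m → ℂ) : Fin m → ℝ :=
  fun i => ‖z i‖

/-- The moment-angle complex `Z_K = ρ⁻¹(cc(K)) ⊆ (D²)^m`. -/
def momentAngleComplex {m : ℕ} (K : PreAbstractSimplicialComplex (Fin m)) : Set (Fin m → ℂ) :=
  polydisc m ∩ orbitMap ⁻¹' cubicalCone K

/-- `X` is a closed topological manifold of dimension `d`: Hausdorff, second countable, compact,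
connected, and locally Euclidean of dimension `d` (hence without boundary): it is covered by open
sets that are homeomorphic to open subsets of `ℝ^d`. -/
structure IsClosedTopManifold (d : ℕ) (X : Type*) [TopologicalSpace X] : Prop where
  hausdorff : T2Space X
  secondCountable : SecondCountableTopology X
  compact : CompactSpace X
  connected : ConnectedSpace X
  locallyEuclidean : Nonempty (ChartedSpace (EuclideanSpace ℝ (Fin d)) X)

/-! Membership in `momentAngleComplex K` depends only on which coordinates lie inside the unit disc:
all norms are at most `1`, and the indices with norm `< 1` form a simplex
(`mem_momentAngleComplex_iff`). Near any point of `ℂ` there are real coordinates `(s, t)` in which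
the closed disc is `t ≥ 0` and the open disc is `t > 0` (`Complex.exists_chart_norm`). In the
product of such charts the complex becomes `ℝ^m` times `simplicialCone K`, the set of nonnegative
`t` whose support is a simplex. That set is the infinite cone over `|K|`, hence homeomorphic to the
cone over `S^{n-1}`, which is `ℝ^n`. The same model serves at every point, so links of simplices
never enter. Compactness holds because the complex is closed in the polydisc; connectedness comes
from products of discs and circles through the point `(1, …, 1)`. -/

/-! ### Restricting charts to subspaces -/

section SubtypeChart

variable {X Y : Type*} [TopologicalSpace X] [TopologicalSpace Y]

open Classical in
/-- An open partial homeomorphism carrying `s` to `t` restricts to an open partial homeomorphism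
between the subspaces `s` and `t`. -/
theorem OpenPartialHomeomorph.IsImage.exists_openPartialHomeomorph_subtype
    {e : OpenPartialHomeomorph X Y} {s : Set X} {t : Set Y} (h : e.IsImage s t)
    (x : s) (hx : (x : X) ∈ e.source) :
    ∃ e' : OpenPartialHomeomorph s t, x ∈ e'.source := by
  have hf : ∀ u : s, (u : X) ∈ e.source → e u ∈ t := fun u hu => (h hu).2 u.2
  have hg : ∀ v : t, (v : Y) ∈ e.target → e.symm v ∈ s := fun v hv =>
    (h.symm_apply_mem_iff hv).2 v.2
  -- The maps must be total; the default values `e x` and `x` are never used on the source and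
  -- target.
  let f : s → t := fun u => if hu : e u ∈ t then ⟨e u, hu⟩ else ⟨e x, hf x hx⟩
  let g : t → s := fun v => if hv : e.symm v ∈ s then ⟨e.symm v, hv⟩ else x
  have hf' : ∀ u : s, (u : X) ∈ e.source → (f u : Y) = e u := fun u hu => by
    simp only [f, dif_pos (hf u hu)]
  have hg' : ∀ v : t, (v : Y) ∈ e.target → (g v : X) = e.symm v := fun v hv => by
    simp only [g, dif_pos (hg v hv)]
  refine ⟨{ toFun := f, invFun := g, source := Subtype.val ⁻¹' e.source,
            target := Subtype.val ⁻¹' e.target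
            map_source' := fun u hu => ?_
            map_target' := fun v hv => ?_
            left_inv' := fun u hu => ?_
            right_inv' := fun v hv => ?_
            open_source := e.open_source.preimage continuous_subtype_val
            open_target := e.open_target.preimage continuous_subtype_val
            continuousOn_toFun := ?_
            continuousOn_invFun := ?_ }, hx⟩
  · simpa only [Set.mem_preimage, hf' u hu] using e.map_source hu
  · simpa only [Set.mem_preimage, hg' v hv] using e.map_target hv
  · have hu' : (f u : Y) ∈ e.target := by rw [hf' u hu]; exact e.map_source hu
    exact Subtype.ext (by rw [hg' _ hu', hf' u hu, e.left_inv hu])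
  · have hv' : (g v : X) ∈ e.source := by rw [hg' v hv]; exact e.map_target hv
    exact Subtype.ext (by rw [hf' _ hv', hg' v hv, e.right_inv hv])
  · rw [Topology.IsInducing.subtypeVal.continuousOn_iff]
    exact (e.continuousOn.comp continuous_subtype_val.continuousOn fun _ hu => hu).congr hf'
  · rw [Topology.IsInducing.subtypeVal.continuousOn_iff]
    exact (e.continuousOn_symm.comp continuous_subtype_val.continuousOn fun _ hu => hu).congr hg'

end SubtypeChart

/-! ### Cones over homeomorphic sections -/

section Cone

variable {E F : Type*} [NormedAddCommGroup E] [NormedSpace ℝ E]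
  [NormedAddCommGroup F] [NormedSpace ℝ F]

/-- `C` is a cone with apex `0`, and `N` is a continuous positively homogeneous function that
dominates the norm on `C`. -/
structure IsGaugedCone (C : Set E) (N : E → ℝ) : Prop where
  zero_mem : (0 : E) ∈ C
  smul_mem : ∀ c : ℝ, 0 ≤ c → ∀ x ∈ C, c • x ∈ C
  continuous_gauge : Continuous N
  gauge_smul : ∀ c : ℝ, 0 ≤ c → ∀ x, N (c • x) = c * N x
  norm_le : ∀ x ∈ C, ‖x‖ ≤ N x

/-- The cross-section of `C` at height `1`. -/
def unitSection (C : Set E) (N : E → ℝ) : Set E := {x | x ∈ C ∧ N x = 1}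

namespace IsGaugedCone

variable {C : Set E} {N : E → ℝ} {D : Set F} {M : F → ℝ}

theorem gauge_nonneg (hC : IsGaugedCone C N) {x : E} (hx : x ∈ C) : 0 ≤ N x :=
  (norm_nonneg x).trans (hC.norm_le x hx)

theorem gauge_zero (hC : IsGaugedCone C N) : N 0 = 0 := by
  simpa using hC.gauge_smul 0 le_rfl 0

theorem eq_zero_of_gauge (hC : IsGaugedCone C N) {x : E} (hx : x ∈ C) (h : N x = 0) : x = 0 :=
  norm_le_zero_iff.1 (h ▸ hC.norm_le x hx)

theorem normalize_mem (hC : IsGaugedCone C N) {x : E} (hx : x ∈ C) (h : N x ≠ 0) :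
    (N x)⁻¹ • x ∈ unitSection C N := by
  have h0 := inv_nonneg.2 (hC.gauge_nonneg hx)
  exact ⟨hC.smul_mem _ h0 _ hx, by rw [hC.gauge_smul _ h0, inv_mul_cancel₀ h]⟩

open Classical in
/-- The radial extension to the cones of a map between the unit sections. -/
noncomputable def radialExt (hC : IsGaugedCone C N) (hD : IsGaugedCone D M)
    (h : unitSection C N → unitSection D M) (x : C) : D :=
  if hx : N x ≠ 0 then
    ⟨N x • (h ⟨(N x)⁻¹ • (x : E), hC.normalize_mem x.2 hx⟩ : F),
      hD.smul_mem _ (hC.gauge_nonneg x.2) _ (h _).2.1⟩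
  else ⟨0, hD.zero_mem⟩

theorem radialExt_of_ne (hC : IsGaugedCone C N) (hD : IsGaugedCone D M)
    (h : unitSection C N → unitSection D M) (x : C) (hx : N x ≠ 0) :
    (radialExt hC hD h x : F) =
      N x • (h ⟨(N x)⁻¹ • (x : E), hC.normalize_mem x.2 hx⟩ : F) := by
  rw [radialExt, dif_pos hx]

theorem radialExt_of_eq (hC : IsGaugedCone C N) (hD : IsGaugedCone D M)
    (h : unitSection C N → unitSection D M) (x : C) (hx : N x = 0) :
    (radialExt hC hD h x : F) = 0 := by
  rw [radialExt, dif_neg (not_not.2 hx)]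

/-- Preservation of height gives both invertibility of the extension and its continuity at the apex.
-/
theorem gauge_radialExt (hC : IsGaugedCone C N) (hD : IsGaugedCone D M)
    (h : unitSection C N → unitSection D M) (x : C) : M (radialExt hC hD h x) = N x := by
  by_cases hx : N x = 0
  · rw [radialExt_of_eq hC hD h x hx, hx, hD.gauge_zero]
  · rw [radialExt_of_ne hC hD h x hx, hD.gauge_smul _ (hC.gauge_nonneg x.2), (h _).2.2, mul_one]

theorem radialExt_radialExt (hC : IsGaugedCone C N) (hD : IsGaugedCone D M)
    (h : unitSection C N → unitSection D M) (k : unitSection D M → unitSection C N)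
    (hk : Function.LeftInverse k h) (x : C) :
    radialExt hD hC k (radialExt hC hD h x) = x := by
  apply Subtype.ext
  have hM := gauge_radialExt hC hD h x
  by_cases hx : N x = 0
  · rw [radialExt_of_eq hD hC k _ (hM.trans hx), hC.eq_zero_of_gauge x.2 hx]
  · have hx' : M (radialExt hC hD h x) ≠ 0 := hM ▸ hx
    have key : (⟨(M (radialExt hC hD h x))⁻¹ • (radialExt hC hD h x : F),
        hD.normalize_mem (radialExt hC hD h x).2 hx'⟩ : unitSection D M) =
        h ⟨(N x)⁻¹ • (x : E), hC.normalize_mem x.2 hx⟩ := by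
      apply Subtype.ext
      change (M (radialExt hC hD h x))⁻¹ • (radialExt hC hD h x : F) = _
      rw [hM, radialExt_of_ne hC hD h x hx, inv_smul_smul₀ hx]
    rw [radialExt_of_ne hD hC k _ hx', key, hk, hM, smul_inv_smul₀ hx]

theorem continuous_radialExt (hC : IsGaugedCone C N) (hD : IsGaugedCone D M)
    (h : unitSection C N → unitSection D M) (hh : Continuous h) :
    Continuous (radialExt hC hD h) := by
  have hN : Continuous fun x : C => N x := hC.continuous_gauge.comp continuous_subtype_val
  rw [Topology.IsInducing.subtypeVal.continuous_iff, continuous_iff_continuousAt]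
  intro x
  by_cases hx : N x = 0
  · rw [ContinuousAt, Function.comp_apply, radialExt_of_eq hC hD h x hx]
    -- At the apex, the norm of the image is bounded by its height `N u`, which tends to `0`.
    refine squeeze_zero_norm (a := fun u : C => N u) (fun u => ?_) ?_
    · rw [← gauge_radialExt hC hD h u]
      exact hD.norm_le _ (radialExt hC hD h u).2
    · simpa only [hx] using hN.tendsto x
  · let U : Set C := {u | N u ≠ 0}
    have hU : IsOpen U := isOpen_ne_fun hN continuous_const
    refine ContinuousOn.continuousAt (s := U) ?_ (hU.mem_nhds hx)
    rw [continuousOn_iff_continuous_domRestrict]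
    have hN' : Continuous fun u : U => N (u : C) := hN.comp continuous_subtype_val
    have : U.domRestrict (Subtype.val ∘ radialExt hC hD h) = fun u : U => N (u : C) •
        (h ⟨(N (u : C))⁻¹ • ((u : C) : E), hC.normalize_mem u.1.2 u.2⟩ : F) :=
      funext fun u => radialExt_of_ne hC hD h u.1 u.2
    rw [this]
    refine hN'.smul (continuous_subtype_val.comp (hh.comp (Continuous.subtype_mk ?_ _)))
    exact (hN'.inv₀ fun u => u.2).smul (continuous_subtype_val.comp continuous_subtype_val)

/-- Homeomorphic unit sections have homeomorphic cones. -/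
noncomputable def homeomorph (hC : IsGaugedCone C N) (hD : IsGaugedCone D M)
    (h : unitSection C N ≃ₜ unitSection D M) : C ≃ₜ D where
  toFun := radialExt hC hD h
  invFun := radialExt hD hC h.symm
  left_inv := radialExt_radialExt hC hD h h.symm h.left_inv
  right_inv := radialExt_radialExt hD hC h.symm h h.right_inv
  continuous_toFun := continuous_radialExt hC hD h h.continuous
  continuous_invFun := continuous_radialExt hD hC h.symm h.symm.continuous

end IsGaugedCone

theorem isGaugedCone_norm : IsGaugedCone (Set.univ : Set E) (fun x => ‖x‖) where
  zero_mem := trivial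
  smul_mem _ _ _ _ := trivial
  continuous_gauge := continuous_norm
  gauge_smul c hc x := by rw [norm_smul, Real.norm_of_nonneg hc]
  norm_le _ _ := le_rfl

theorem unitSection_norm {E : Type*} [NormedAddCommGroup E] :
    unitSection (Set.univ : Set E) (fun x => ‖x‖) = Metric.sphere 0 1 := by
  ext x
  simp [unitSection]

end Cone

/-! ### The cone over a simplicial complex -/

section SimplicialCone

variable {m : ℕ}

/-- `I` is a simplex of `K`, the empty simplex included. -/
def PreAbstractSimplicialComplex.IsSimplex (K : PreAbstractSimplicialComplex (Fin m))
    (I : Finset (Fin m)) : Prop :=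
  I = ∅ ∨ I ∈ K.faces

theorem PreAbstractSimplicialComplex.IsSimplex.mono {K : PreAbstractSimplicialComplex (Fin m)}
    {I J : Finset (Fin m)} (hJ : K.IsSimplex J) (hIJ : I ⊆ J) : K.IsSimplex I := by
  rcases I.eq_empty_or_nonempty with rfl | hI
  · exact Or.inl rfl
  · rcases hJ with rfl | hJ
    · exact absurd (Finset.subset_empty.1 hIJ) hI.ne_empty
    · exact Or.inr ((K.isRelLowerSet_faces hJ).2 hIJ hI)

/-- The points of the nonnegative orthant whose support is a simplex of `K`. -/
def simplicialCone (K : PreAbstractSimplicialComplex (Fin m)) : Set (Fin m → ℝ) :=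
  {x | (∀ i, 0 ≤ x i) ∧ K.IsSimplex {i | 0 < x i}}

theorem isGaugedCone_simplicialCone (K : PreAbstractSimplicialComplex (Fin m)) :
    IsGaugedCone (simplicialCone K) (fun x => ∑ i, x i) where
  zero_mem := ⟨fun _ => le_rfl, Or.inl (by simp)⟩
  smul_mem c hc x hx := by
    refine ⟨fun i => mul_nonneg hc (hx.1 i), hx.2.mono fun i hi => ?_⟩
    simp only [Finset.mem_filter, Finset.mem_univ, true_and, Pi.smul_apply, smul_eq_mul] at hi ⊢
    exact pos_of_mul_pos_right hi hc
  continuous_gauge := by fun_prop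
  gauge_smul c _ x := by simp [Finset.mul_sum]
  norm_le x hx := by
    refine (pi_norm_le_iff_of_nonneg (Finset.sum_nonneg fun i _ => hx.1 i)).2 fun i => ?_
    rw [Real.norm_of_nonneg (hx.1 i)]
    exact Finset.single_le_sum (fun j _ => hx.1 j) (Finset.mem_univ i)

theorem unitSection_simplicialCone (K : PreAbstractSimplicialComplex (Fin m)) :
    unitSection (simplicialCone K) (fun x => ∑ i, x i) = geomRealization K := by
  ext x
  simp only [geomRealization, Set.mem_iUnion, unitSection, exists_prop]
  constructor
  · rintro ⟨⟨hx0, hx⟩, hsum⟩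
    have hx' : ({i | 0 < x i} : Finset (Fin m)) ∈ K.faces := by
      refine hx.resolve_left fun he => ?_
      have : ∀ i, x i = 0 := fun i => le_antisymm
        (not_lt.1 fun hi => (Finset.notMem_empty i) (he ▸ by simpa using hi)) (hx0 i)
      simp [this] at hsum
    refine ⟨_, hx', ?_⟩
    have hz : ∀ i ∉ ({i | 0 < x i} : Finset (Fin m)), x i = 0 := fun i hi =>
      le_antisymm (not_lt.1 (by simpa using hi)) (hx0 i)
    -- The coordinates of `x` are its barycentric coordinates in the simplex spanned by its support.
    have hrep : x = ∑ i ∈ ({i | 0 < x i} : Finset (Fin m)), x i • (Pi.single i 1 : Fin m → ℝ) := by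
      rw [Finset.sum_subset (Finset.subset_univ _) fun i _ hi => by rw [hz i hi, zero_smul]]
      ext j
      simp [Finset.sum_apply, Pi.single_apply]
    rw [hrep]
    refine (convex_convexHull ℝ _).sum_mem (fun i _ => hx0 i) ?_ fun i hi =>
      subset_convexHull ℝ _ ⟨i, ?_, rfl⟩
    · rw [← hsum]
      exact Finset.sum_subset (Finset.subset_univ _) fun i _ hi => hz i hi
    · rw [← hrep]
      exact hi
  · rintro ⟨I, hI, hx⟩
    have hconv : Convex ℝ {y : Fin m → ℝ |
        (∀ i, 0 ≤ y i) ∧ ∑ i, y i = 1 ∧ ∀ i ∉ I, y i = 0} := by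
      rintro y ⟨hy0, hy1, hyI⟩ z ⟨hz0, hz1, hzI⟩ a b ha hb hab
      refine ⟨fun i => ?_, ?_, fun i hi => ?_⟩
      · exact add_nonneg (mul_nonneg ha (hy0 i)) (mul_nonneg hb (hz0 i))
      · simp [Finset.sum_add_distrib, ← Finset.mul_sum, hy1, hz1, hab]
      · simp [hyI i hi, hzI i hi]
    have hsub := convexHull_min (s := (fun i : Fin m => (Pi.single i 1 : Fin m → ℝ)) '' I)
      (by
        rintro _ ⟨j, hj, rfl⟩
        refine ⟨fun i => ?_, by simp, fun i hi => ?_⟩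
        · by_cases hij : i = j <;> simp [hij]
        · exact Pi.single_eq_of_ne (fun hij => hi (by rwa [hij])) _) hconv
    obtain ⟨h0, h1, hI0⟩ := hsub hx
    have hIs : K.IsSimplex I := Or.inr hI
    refine ⟨⟨h0, hIs.mono fun i hi => ?_⟩, h1⟩
    by_contra hiI
    simp [hI0 i hiI] at hi

/-- Both spaces are cones, over `|K|` and over the unit sphere. For `n = 0` the sections are empty
and both cones reduce to the apex. -/
theorem IsSimplicialSphere.nonempty_simplicialCone_homeomorph {n : ℕ}
    {K : PreAbstractSimplicialComplex (Fin m)} (hK : IsSimplicialSphere n K) :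
    Nonempty (simplicialCone K ≃ₜ EuclideanSpace ℝ (Fin n)) := by
  obtain ⟨h⟩ := hK
  have h' := (Homeomorph.setCongr (unitSection_simplicialCone K)).trans
    (h.trans (Homeomorph.setCongr unitSection_norm.symm))
  exact ⟨((isGaugedCone_simplicialCone K).homeomorph isGaugedCone_norm h').trans
    (Homeomorph.Set.univ _)⟩

end SimplicialCone

/-! ### Charts of the moment-angle complex -/

section Charts

/-- Around every point of `ℂ` there are coordinates whose second component detects the position
relative to the unit circle. -/
theorem Complex.exists_chart_norm (w : ℂ) :
    ∃ e : OpenPartialHomeomorph ℂ (ℝ × ℝ), w ∈ e.source ∧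
      ∀ u ∈ e.source, (‖u‖ ≤ 1 ↔ 0 ≤ (e u).2) ∧ (‖u‖ < 1 ↔ 0 < (e u).2) := by
  rcases eq_or_ne w 0 with rfl | hw
  -- Near `0` every point is inside the disc, so the second coordinate only has to be positive: the
  -- shift by `1 / 2` ensures this on the ball of radius `1 / 2`.
  · let φ : ℂ ≃ₜ ℝ × ℝ := Complex.equivRealProdCLM.toHomeomorph.trans
      (Homeomorph.addRight ((0 : ℝ), (1 / 2 : ℝ)))
    have hopen : IsOpen (Metric.ball (0 : ℂ) (1 / 2)) := Metric.isOpen_ball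
    refine ⟨φ.toOpenPartialHomeomorph.restrOpen _ hopen, by simp, fun u hu => ?_⟩
    have hu' : ‖u‖ < 1 / 2 := by simpa using hu
    have hφ : (φ u).2 = u.im + 1 / 2 := rfl
    have him := (abs_lt.1 ((Complex.abs_im_le_norm u).trans_lt hu')).1
    have h1 : ‖u‖ < 1 := by linarith
    have h2 : 0 < (φ u).2 := by rw [hφ]; linarith
    exact ⟨iff_of_true h1.le h2.le, iff_of_true h1 h2⟩
  -- Rotating `w` onto the positive real axis avoids the cut of the polar coordinates `(r, θ)`,
  -- which are then turned into `(θ, 1 - r)`.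
  · have hc : (‖w‖ : ℂ) / w ≠ 0 := div_ne_zero (by simpa using hw) hw
    have hn : ‖(‖w‖ : ℂ) / w‖ = 1 := by simp [hw]
    let ψ : ℝ × ℝ ≃ₜ ℝ × ℝ := (Homeomorph.prodComm ℝ ℝ).trans
      ((Homeomorph.refl ℝ).prodCongr (Homeomorph.subLeft 1))
    let e := ((Homeomorph.mulLeft₀ _ hc).transOpenPartialHomeomorph
      Complex.polarCoord).transHomeomorph ψ
    have he : ∀ u, (e u).2 = 1 - ‖u‖ := fun u => by
      change 1 - (Complex.polarCoord ((‖w‖ : ℂ) / w * u)).1 = _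
      rw [Complex.polarCoord_apply, norm_mul, hn, one_mul]
    refine ⟨e, ?_, fun u _ => ?_⟩
    · change (‖w‖ : ℂ) / w * w ∈ Complex.slitPlane
      rw [div_mul_cancel₀ _ hw]
      exact Complex.ofReal_mem_slitPlane.2 (norm_pos_iff.2 hw)
    · rw [he, sub_nonneg, sub_pos]
      exact ⟨Iff.rfl, Iff.rfl⟩

variable {m : ℕ}

/-- The set of indices with norm `< 1` is the least admissible `J`, and `I = ∅` imposes no
condition. -/
theorem mem_momentAngleComplex_iff {K : PreAbstractSimplicialComplex (Fin m)} {z : Fin m → ℂ} :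
    z ∈ momentAngleComplex K ↔ (∀ i, ‖z i‖ ≤ 1) ∧ K.IsSimplex {i | ‖z i‖ < 1} := by
  constructor
  · rintro ⟨hz, I, J, -, hJ, hy⟩
    refine ⟨hz, PreAbstractSimplicialComplex.IsSimplex.mono hJ fun i hi => ?_⟩
    by_contra hiJ
    have : ‖z i‖ = 1 := hy.2.2 i hiJ
    simp [this] at hi
  · rintro ⟨hz, hJ⟩
    refine ⟨hz, ∅, _, Finset.empty_subset _, hJ, fun i => ⟨norm_nonneg _, hz i⟩, by simp,
      fun i hi => le_antisymm (hz i) (not_lt.1 fun h => hi (by simpa [orbitMap] using h))⟩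

/-- A condition on the second components of points of `(ℝ × ℝ)^ι` cuts out a product. -/
def homeomorphProdOfSnd {ι : Type*} (C : Set (ι → ℝ)) :
    {p : ι → ℝ × ℝ | (fun i => (p i).2) ∈ C} ≃ₜ (ι → ℝ) × C where
  toFun p := (fun i => (p.1 i).1, ⟨fun i => (p.1 i).2, p.2⟩)
  invFun q := ⟨fun i => (q.1 i, q.2.1 i), q.2.2⟩
  left_inv _ := rfl
  right_inv _ := rfl
  continuous_toFun := by
    have h : Continuous fun p : {p : ι → ℝ × ℝ | (fun i => (p i).2) ∈ C} => p.1 :=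
      continuous_subtype_val
    exact (continuous_pi fun i => ((continuous_apply i).comp h).fst).prodMk
      ((continuous_pi fun i => ((continuous_apply i).comp h).snd).subtype_mk _)
  continuous_invFun := by
    refine Continuous.subtype_mk (continuous_pi fun i => ?_) _
    exact ((continuous_apply i).comp continuous_fst).prodMk
      ((continuous_apply i).comp (continuous_subtype_val.comp continuous_snd))

theorem momentAngleComplex_exists_chart {n : ℕ} {K : PreAbstractSimplicialComplex (Fin m)}
    (hK : IsSimplicialSphere n K) (z : momentAngleComplex K) :
    ∃ e : OpenPartialHomeomorph (momentAngleComplex K) (EuclideanSpace ℝ (Fin (m + n))),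
      z ∈ e.source := by
  choose e hmem he using fun i => Complex.exists_chart_norm (z.1 i)
  have himg : (OpenPartialHomeomorph.pi e).IsImage (momentAngleComplex K)
      {p | (fun i => (p i).2) ∈ simplicialCone K} := by
    intro u hu
    have hu' : ∀ i, u i ∈ (e i).source := fun i => hu i trivial
    rw [mem_momentAngleComplex_iff]
    -- The norm conditions become sign conditions on the second coordinates, which are those
    -- defining `simplicialCone K`.
    simp only [fun i => (he i (u i) (hu' i)).1, fun i => (he i (u i) (hu' i)).2]
    rfl
  obtain ⟨e', he'⟩ := himg.exists_openPartialHomeomorph_subtype z fun i _ => hmem i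
  obtain ⟨h⟩ := hK.nonempty_simplicialCone_homeomorph
  have L : ((Fin m → ℝ) × EuclideanSpace ℝ (Fin n)) ≃L[ℝ] EuclideanSpace ℝ (Fin (m + n)) :=
    ContinuousLinearEquiv.ofFinrankEq (by simp)
  exact ⟨e'.transHomeomorph ((homeomorphProdOfSnd _).trans
    (((Homeomorph.refl _).prodCongr h).trans L.toHomeomorph)), he'⟩

end Charts

/-! ### Compactness and connectedness -/

section Global

variable {m : ℕ}

theorem isClosed_cubeFace (I J : Finset (Fin m)) : IsClosed (cubeFace I J) := by
  simp only [cubeFace, Set.ofPred_and, Set.ofPred_forall]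
  refine IsClosed.inter (isClosed_iInter fun i => isClosed_Icc.preimage (continuous_apply i))
    (IsClosed.inter ?_ ?_) <;>
  exact isClosed_iInter fun i => isClosed_iInter fun _ =>
    isClosed_eq (continuous_apply i) continuous_const

theorem isClosed_cubicalCone (K : PreAbstractSimplicialComplex (Fin m)) :
    IsClosed (cubicalCone K) := by
  have : cubicalCone K = ⋃ p ∈ {p : Finset (Fin m) × Finset (Fin m) |
      p.1 ⊆ p.2 ∧ (p.2 = ∅ ∨ p.2 ∈ K.faces)}, cubeFace p.1 p.2 := by
    ext y
    simp [cubicalCone, and_assoc]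
  rw [this]
  exact (Set.toFinite _).isClosed_biUnion fun p _ => isClosed_cubeFace p.1 p.2

theorem isCompact_momentAngleComplex (K : PreAbstractSimplicialComplex (Fin m)) :
    IsCompact (momentAngleComplex K) := by
  have hpoly : polydisc m = Set.univ.pi fun _ => Metric.closedBall (0 : ℂ) 1 := by
    ext z
    simp [polydisc]
  have hcont : Continuous (orbitMap (m := m)) := by
    unfold orbitMap
    fun_prop
  rw [momentAngleComplex, hpoly]
  exact (isCompact_univ_pi fun _ => isCompact_closedBall _ _).inter_right
    ((isClosed_cubicalCone K).preimage hcont)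

theorem isConnected_momentAngleComplex (K : PreAbstractSimplicialComplex (Fin m)) :
    IsConnected (momentAngleComplex K) := by
  have h1 : (1 : Fin m → ℂ) ∈ momentAngleComplex K :=
    mem_momentAngleComplex_iff.2 ⟨by simp, Or.inl (by simp)⟩
  refine ⟨⟨1, h1⟩, isPreconnected_of_forall 1 fun z hz => ?_⟩
  rw [mem_momentAngleComplex_iff] at hz
  -- This product of discs and circles contains `z` and `1`. It stays in the complex because only
  -- indices of the simplex of `z` can have norm `< 1`.
  refine ⟨Set.univ.pi fun i => if ‖z i‖ < 1 then Metric.closedBall (0 : ℂ) 1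
    else Metric.sphere (0 : ℂ) 1, fun u hu => ?_, fun i _ => ?_, fun i _ => ?_,
    isPreconnected_univ_pi fun i => ?_⟩
  · have hu' : ∀ i, ‖u i‖ ≤ 1 ∧ (¬ ‖z i‖ < 1 → ‖u i‖ = 1) := fun i => by
      have := hu i trivial
      by_cases hi : ‖z i‖ < 1
      · simpa [hi] using this
      · have h' : ‖u i‖ = 1 := by simpa [hi] using this
        exact ⟨h'.le, fun _ => h'⟩
    refine mem_momentAngleComplex_iff.2 ⟨fun i => (hu' i).1, hz.2.mono fun i hi => ?_⟩
    simp only [Finset.mem_filter, Finset.mem_univ, true_and] at hi ⊢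
    by_contra hzi
    exact hi.ne ((hu' i).2 hzi)
  · by_cases hi : ‖z i‖ < 1 <;> simp [hi]
  · by_cases hi : ‖z i‖ < 1
    · simpa [hi] using hi.le
    · simpa [hi] using le_antisymm (hz.1 i) (not_lt.1 hi)
  · by_cases hi : ‖z i‖ < 1
    · simpa [hi] using (convex_closedBall (0 : ℂ) 1).isPreconnected
    · simpa [hi] using isPreconnected_sphere
        (by rw [Complex.rank_real_complex]; exact Nat.one_lt_ofNat) (0 : ℂ) 1

end Global

theorem lemma3p7 (m n : ℕ) (K : PreAbstractSimplicialComplex (Fin m))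
    (hK : IsSimplicialSphere n K) :
    IsClosedTopManifold (m + n) (momentAngleComplex K) := by
  refine ⟨inferInstance, inferInstance, isCompact_iff_compactSpace.1
    (isCompact_momentAngleComplex K), isConnected_iff_connectedSpace.1
    (isConnected_momentAngleComplex K), ?_⟩
  choose e he using momentAngleComplex_exists_chart hK
  exact ⟨{ atlas := Set.range e, chartAt := e, mem_chart_source := he
           chart_mem_atlas := Set.mem_range_self }⟩
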